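/- Let $\Bbbk$ be a field, $S=\Bbbk[x,y,z]$, $\mathfrak m=\langle x,y,z\rangle$, and let $I$ be an $\mathfrak m$-primary monomial ideal of $S$, minimally generated by the monomials $m_1,\dots,m_n$ (listed in any order). Put $R=S/I$, let $K$ be the Koszul complex on the images of $x,y,z$ in $R$, let $A=H(K)$ with the product induced by the exterior product, and let $A_1^2\subseteq A_2$ be the $\Bbbk$-span of all products of two elements of $A_1$. Let $f_1\colon S^n\to S$ be given by $e_i\mapsto m_i$, let $Z_2=\ker f_1$, and for $1\le i<j\le n$ put $m_{ij}=\operatorname{lcm}(m_i,m_j)$ and $\sigma_{ij}=\frac{m_{ij}}{m_j}e_j-\frac{m_{ij}}{m_i}e_i\in Z_2$. Order the $\sigma_{ij}$ by the dictionary order on their indices: $\sigma_{ij}<\sigma_{kl}$ if $i<k$, or $i=k$ and $j<l$. Let $S_2$ (the set of ordered minimal second syzygies) be the set of those $\sigma_{ij}$ such that 1. $\sigma_{ij}\in Z_2\setminus\mathfrak m Z_2$, and 2. $\sigma_{ij}$ cannot be written as $\sum_{k<l}a_{kl}\sigma_{kl}$ with $a_{kl}\in S$ such that $\sigma_{ij}<\sigma_{kl}$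 for all $k<l$ with $a_{kl}\notin\mathfrak m$. Let $f_2$ be the matrix with $n$ rows whose columns are the elements of $S_2$. Then $p=\operatorname{rank}_{\Bbbk}(A_1^2)$ equals the number of distinct $\sigma_{ij}\in S_2$ all of whose nonzero entries lie in $I$. In other words, $p$ is the number of columns of $f_2$ all of whose entries lie in $I$. -/

import Mathlib

namespace TrivariateKoszul

/-! ### The Koszul complex on three elements, and the product on its homology

`K : 0 → R → R³ → R³ → R → 0`, with bases `e₁, e₂, e₃` in degree `1`,
`e₁₂, e₁₃, e₂₃` in degree `2` and `e₁₂₃` in degree `3`. -/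

section Koszul

variable {R : Type*} [CommRing R]

/-- `φ₁ = [x y z]`, i.e. `eᵢ ↦ xᵢ`. -/
def phi1 (x : Fin 3 → R) : (Fin 3 → R) →ₗ[R] R :=
  Fintype.linearCombination R x

/-- `φ₂`: `e₁₂ ↦ x e₂ - y e₁`, `e₁₃ ↦ x e₃ - z e₁`, `e₂₃ ↦ y e₃ - z e₂`. -/
def phi2 (x : Fin 3 → R) : (Fin 3 → R) →ₗ[R] (Fin 3 → R) :=
  Matrix.mulVecLin !![-x 1, -x 2, 0; x 0, 0, -x 2; 0, x 0, x 1]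

/-- `φ₃`: `e₁₂₃ ↦ z e₁₂ - y e₁₃ + x e₂₃`. -/
def phi3 (x : Fin 3 → R) : R →ₗ[R] (Fin 3 → R) :=
  LinearMap.toSpanSingleton R (Fin 3 → R) ![x 2, -x 1, x 0]

/-- The exterior product `K₁ × K₁ → K₂`, written in the bases `eᵢ` and `e₁₂, e₁₃, e₂₃`. -/
def wedge : (Fin 3 → R) →ₗ[R] (Fin 3 → R) →ₗ[R] (Fin 3 → R) :=
  LinearMap.mk₂ R
    (fun u v => ![u 0 * v 1 - u 1 * v 0, u 0 * v 2 - u 2 * v 0, u 1 * v 2 - u 2 * v 1])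
    (fun u u' v => by ext i; fin_cases i <;> simp <;> ring)
    (fun c u v => by ext i; fin_cases i <;> simp <;> ring)
    (fun u v v' => by ext i; fin_cases i <;> simp <;> ring)
    (fun c u v => by ext i; fin_cases i <;> simp <;> ring)

theorem phi1_phi2 (x w : Fin 3 → R) : phi1 x (phi2 x w) = 0 := by
  simp [phi1, phi2, Fintype.linearCombination_apply, Fin.sum_univ_three,
    dotProduct]
  ring

theorem phi2_phi3 (x : Fin 3 → R) (c : R) : phi2 x (phi3 x c) = 0 := by
  ext i
  fin_cases i <;>
    simp [phi2, phi3, Fin.sum_univ_three, Matrix.mulVec, dotProduct] <;> ring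

/-- Leibniz rule for two elements of degree `1`. -/
theorem phi2_wedge (x u v : Fin 3 → R) :
    phi2 x (wedge u v) = phi1 x u • v - phi1 x v • u := by
  ext i
  fin_cases i <;>
    simp [phi1, phi2, wedge, Fintype.linearCombination_apply, Fin.sum_univ_three,
      Matrix.mulVec, dotProduct] <;> ring

/-- Leibniz rule for an element of degree `2` and one of degree `1`. -/
theorem wedge_phi2_left (x w v : Fin 3 → R) :
    wedge (phi2 x w) v
      = phi3 x (w 0 * v 2 - w 1 * v 1 + w 2 * v 0) - phi1 x v • w := by
  ext i
  fin_cases i <;>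
    simp [phi1, phi2, phi3, wedge, Fintype.linearCombination_apply, Fin.sum_univ_three,
      dotProduct] <;> ring

theorem wedge_swap (u v : Fin 3 → R) : wedge u v = -wedge v u := by
  ext i
  fin_cases i <;> simp [wedge] <;> ring

/-- Boundaries in degree `1`, inside the cycles. -/
def B1 (x : Fin 3 → R) : Submodule R (LinearMap.ker (phi1 x)) :=
  (LinearMap.range (phi2 x)).comap (LinearMap.ker (phi1 x)).subtype

/-- Boundaries in degree `2`, inside the cycles. -/
def B2 (x : Fin 3 → R) : Submodule R (LinearMap.ker (phi2 x)) :=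
  (LinearMap.range (phi3 x)).comap (LinearMap.ker (phi2 x)).subtype

/-- `A₁ = H₁(K)`. -/
abbrev A1 (x : Fin 3 → R) : Type _ := LinearMap.ker (phi1 x) ⧸ B1 x

/-- `A₂ = H₂(K)`. -/
abbrev A2 (x : Fin 3 → R) : Type _ := LinearMap.ker (phi2 x) ⧸ B2 x

/-- The exterior product of two `1`-cycles, a `2`-cycle. -/
def wedgeCycles (x : Fin 3 → R) :
    LinearMap.ker (phi1 x) →ₗ[R] LinearMap.ker (phi1 x) →ₗ[R] LinearMap.ker (phi2 x) :=
  LinearMap.mk₂ R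
    (fun u v => ⟨wedge u.1 v.1, by
      have hu : phi1 x u.1 = 0 := u.2
      have hv : phi1 x v.1 = 0 := v.2
      simp [LinearMap.mem_ker, phi2_wedge, hu, hv]⟩)
    (fun u u' v => by ext1; simp)
    (fun c u v => by ext1; simp)
    (fun u v v' => by ext1; simp)
    (fun c u v => by ext1; simp)

theorem wedgeCycles_mem_left (x : Fin 3 → R) (u v : LinearMap.ker (phi1 x)) (hu : u ∈ B1 x) :
    wedgeCycles x u v ∈ B2 x := by
  obtain ⟨w, hw⟩ := hu
  have hv : phi1 x v.1 = 0 := v.2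
  refine ⟨w 0 * v.1 2 - w 1 * v.1 1 + w 2 * v.1 0, ?_⟩
  have h := wedge_phi2_left x w v.1
  rw [hv, zero_smul, sub_zero] at h
  rw [← h, hw]
  rfl

theorem wedgeCycles_mem_right (x : Fin 3 → R) (u v : LinearMap.ker (phi1 x)) (hv : v ∈ B1 x) :
    wedgeCycles x u v ∈ B2 x := by
  have h : wedgeCycles x u v = -wedgeCycles x v u := by
    ext1
    exact wedge_swap u.1 v.1
  rw [h]
  exact neg_mem (wedgeCycles_mem_left x v u hv)

/-- The product `A₁ × A₁ → A₂` induced on homology by the exterior product. -/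
def mulA (x : Fin 3 → R) : A1 x →ₗ[R] A1 x →ₗ[R] A2 x :=
  (B1 x).liftQ
    (LinearMap.mk₂ R
      (fun (u : LinearMap.ker (phi1 x)) (b : A1 x) =>
        (B1 x).liftQ ((B2 x).mkQ ∘ₗ wedgeCycles x u) (by
          intro v hv
          simpa using wedgeCycles_mem_right x u v hv) b)
      (fun u u' b => by
        obtain ⟨v, rfl⟩ := (B1 x).mkQ_surjective b
        simp)
      (fun c u b => by
        obtain ⟨v, rfl⟩ := (B1 x).mkQ_surjective b
        simp)
      (fun u b b' => by simp)
      (fun c u b => by simp))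
    (by
      intro u hu
      rw [LinearMap.mem_ker]
      refine LinearMap.ext fun b => ?_
      obtain ⟨v, rfl⟩ := (B1 x).mkQ_surjective b
      simpa using wedgeCycles_mem_left x u v hu)

/-- `mulA` is what it should be on classes of cycles. -/
theorem mulA_mk (x : Fin 3 → R) (u v : LinearMap.ker (phi1 x)) :
    mulA x ((B1 x).mkQ u) ((B1 x).mkQ v) = (B2 x).mkQ (wedgeCycles x u v) := by
  simp [mulA]

/-- `A₁²`: the `k`-subspace of `A₂` spanned by the products of two elements of `A₁`. -/
def A1sq (k : Type*) [Field k] [Algebra k R] (x : Fin 3 → R) : Submodule k (A2 x) :=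
  Submodule.span k {c | ∃ a b : A1 x, c = mulA x a b}

end Koszul

/-! ### Monomial ideals and second syzygies -/

section Monomial

variable (k : Type*) [Field k]

/-- The homogeneous maximal ideal `𝔪 = ⟨x, y, z⟩` of `S = k[x, y, z]`. -/
noncomputable def maxIdeal : Ideal (MvPolynomial (Fin 3) k) :=
  Ideal.span (Set.range MvPolynomial.X)

variable {n : ℕ}

/-- The monomial with exponent vector `e`. -/
noncomputable def mono (e : Fin 3 →₀ ℕ) : MvPolynomial (Fin 3) k :=
  MvPolynomial.monomial e 1

/-- `I` is minimally generated by the monomials with exponent vectors `m 0, …, m (n - 1)`: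
they generate `I`, and none of them lies in the ideal generated by the others. -/
def IsMinGenBy (I : Ideal (MvPolynomial (Fin 3) k)) (m : Fin n → Fin 3 →₀ ℕ) : Prop :=
  I = Ideal.span (Set.range fun i => mono k (m i)) ∧
    ∀ i, mono k (m i) ∉ Ideal.span ((fun j => mono k (m j)) '' {j | j ≠ i})

/-- `f₁ : Sⁿ → S`, `eᵢ ↦ mᵢ`. -/
noncomputable def f1 (m : Fin n → Fin 3 →₀ ℕ) :
    (Fin n → MvPolynomial (Fin 3) k) →ₗ[MvPolynomial (Fin 3) k] MvPolynomial (Fin 3) k :=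
  Fintype.linearCombination _ fun i => mono k (m i)

/-- `Z₂`, the module of all second syzygies of `S/I`. -/
noncomputable def Z2 (m : Fin n → Fin 3 →₀ ℕ) :
    Submodule (MvPolynomial (Fin 3) k) (Fin n → MvPolynomial (Fin 3) k) :=
  LinearMap.ker (f1 k m)

/-- `σᵢⱼ = (mᵢⱼ / mⱼ) eⱼ - (mᵢⱼ / mᵢ) eᵢ`, where `mᵢⱼ = lcm(mᵢ, mⱼ)` has exponent vector
`m i ⊔ m j` (so that the two subtractions of exponents are not truncated). -/
noncomputable def sigma (m : Fin n → Fin 3 →₀ ℕ) (i j : Fin n) :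
    Fin n → MvPolynomial (Fin 3) k :=
  Pi.single j (mono k (m i ⊔ m j - m j)) - Pi.single i (mono k (m i ⊔ m j - m i))

theorem sigma_mem_Z2 (m : Fin n → Fin 3 →₀ ℕ) (i j : Fin n) : sigma k m i j ∈ Z2 k m := by
  have h1 : m i ⊔ m j - m j + m j = m i ⊔ m j := tsub_add_cancel_of_le le_sup_right
  have h2 : m i ⊔ m j - m i + m i = m i ⊔ m j := tsub_add_cancel_of_le le_sup_left
  simp [Z2, f1, sigma, mono, Fintype.linearCombination_apply_single,
    MvPolynomial.monomial_mul, h1, h2]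

/-- Dictionary order on the indices of the `σᵢⱼ`. -/
def IdxLT (i j p q : Fin n) : Prop := i < p ∨ (i = p ∧ j < q)

/-- `σᵢⱼ` (`i < j`) is an ordered minimal second syzygy:
it is a minimal second syzygy, and it is not a combination of the `σ_{pq}` (`p < q`) in which every
`σ_{pq}` whose coefficient is a unit is strictly larger than `σᵢⱼ`. "Unit" is meant locally at `𝔪`,
i.e. the coefficient is not in `𝔪`; for the multihomogeneous combinations, whose coefficients
are scalar multiples of monomials, this is the same as being a unit of `S`. -/
def IsOrderedMinimal (m : Fin n → Fin 3 →₀ ℕ) (i j : Fin n) : Prop :=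
  i < j ∧
  (sigma k m i j ∈ Z2 k m ∧ sigma k m i j ∉ maxIdeal k • Z2 k m) ∧
  ¬ ∃ a : Fin n → Fin n → MvPolynomial (Fin 3) k,
      sigma k m i j = ∑ p, ∑ q ∈ Finset.Ioi p, a p q • sigma k m p q ∧
      ∀ p q, p < q → a p q ∉ maxIdeal k → IdxLT i j p q

/-- `S₂`, the set of ordered minimal second syzygies. -/
def S2 (m : Fin n → Fin 3 →₀ ℕ) : Set (Fin n → MvPolynomial (Fin 3) k) :=
  {s | ∃ i j, IsOrderedMinimal k m i j ∧ s = sigma k m i j}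

/-- The matrix `f₂` of the maximal ordered resolution: its columns are the `σᵢⱼ` in `S₂`. -/
noncomputable def f2 (m : Fin n → Fin 3 →₀ ℕ) :
    Matrix (Fin n) {c : Fin n × Fin n // IsOrderedMinimal k m c.1 c.2}
      (MvPolynomial (Fin 3) k) :=
  Matrix.of fun r c => sigma k m c.1.1 c.1.2 r

/-- The images of `x, y, z` in `R = S/I`. -/
noncomputable def vars (I : Ideal (MvPolynomial (Fin 3) k)) : Fin 3 → MvPolynomial (Fin 3) k ⧸ I :=
  fun i => Ideal.Quotient.mk I (MvPolynomial.X i)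

end Monomial

end TrivariateKoszul

/-!
The proof identifies one explicit set of pairs that both sides count. Call a pair `i < j` *isolated*
if `mᵢ`, `mⱼ` are coprime and are the only generators dividing `mᵢ mⱼ`.

*Syzygies.* By minimality of the generators, all entries of `σᵢⱼ` lie in `I` exactly when `mᵢ` and
`mⱼ` are coprime. If they are coprime but a third generator `m_l` divides `mᵢ mⱼ`, then `σᵢⱼ` is a
combination of `σ_{lj}` and `σ_{il}` with coefficients in `𝔪`, so it is not a minimal syzygy. If the pair is isolated, then
`σᵢⱼ` is the only `σ_{pq}` whose multidegree divides `mᵢ mⱼ`, and comparing the coefficient of `mᵢ` in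
coordinate `j` shows that `σᵢⱼ` is minimal and occurs with a coefficient outside `𝔪` in every
expression through the `σ_{pq}`. Hence the columns with entries in `I` correspond to isolated pairs
(`isOrderedMinimal_and_mem_iff`); the order on the `σ_{pq}` plays no role for them.

*Homology.* `A₁` is generated by the classes of the cycles `(mᵢ / x_t) e_t`, where the choice of
`x_t ∣ mᵢ` is irrelevant (`exists_eq_sum_monoClass`, `monoClass_eq`), and `𝔪` annihilates `A₂`. So
`A₁²` is spanned over `k` by the products of two such classes. For a pair that is not isolated, a
suitable choice of the variables makes the product of the two cycles zero (`genProduct_eq_zero`). The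
products of isolated pairs are linearly independent (`linearIndependent_genProduct`): in the
multidegree `mᵢ mⱼ` there is a functional `pairCoeff` on `K₂`, lifted to `S`, that kills boundaries
and everything with entries in `I`, and takes the value `1` on the product of the cycles of `mᵢ` and
`mⱼ`.
-/

namespace TrivariateKoszul

open MvPolynomial

/-! ### The Koszul complex -/

section KoszulComplex

variable {R R' : Type*} [CommRing R] [CommRing R']

/-- Left multiplication by `e_t` is a homotopy for multiplication by `x_t`. -/
theorem smul_A2_eq_zero (x : Fin 3 → R) (t : Fin 3) (ξ : A2 x) : x t • ξ = 0 := by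
  obtain ⟨w, rfl⟩ := (B2 x).mkQ_surjective ξ
  rw [← map_smul, Submodule.mkQ_apply, Submodule.Quotient.mk_eq_zero]
  have h := wedge_phi2_left x w.1 (Pi.single t 1)
  have hw : phi2 x w.1 = 0 := w.2
  have h1 : phi1 x (Pi.single t 1) = x t := by
    simp [phi1, Fintype.linearCombination_apply_single]
  rw [hw, h1, map_zero, LinearMap.zero_apply] at h
  exact ⟨_, sub_eq_zero.1 h.symm⟩

theorem mul_smul_A2_eq_zero (x : Fin 3 → R) (r : R) (t : Fin 3) (ξ : A2 x) :
    (r * x t) • ξ = 0 := by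
  rw [mul_smul, smul_A2_eq_zero, smul_zero]

theorem phi1_comp_ringHom (f : R →+* R') (x u : Fin 3 → R) :
    phi1 (f ∘ x) (f ∘ u) = f (phi1 x u) := by
  simp [phi1, Fintype.linearCombination_apply]

theorem phi2_comp_ringHom (f : R →+* R') (x w : Fin 3 → R) :
    phi2 (f ∘ x) (f ∘ w) = f ∘ phi2 x w := by
  ext i
  fin_cases i <;> simp [phi2, dotProduct, Fin.sum_univ_three]

theorem phi3_comp_ringHom (f : R →+* R') (x : Fin 3 → R) (c : R) :
    phi3 (f ∘ x) (f c) = f ∘ phi3 x c := by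
  ext i
  fin_cases i <;> simp [phi3]

theorem wedge_comp_ringHom (f : R →+* R') (u v : Fin 3 → R) :
    wedge (f ∘ u) (f ∘ v) = f ∘ wedge u v := by
  ext i
  fin_cases i <;> simp [wedge]

theorem wedge_single_eq_zero {s t : Fin 3} {a b : R} (h : s = t ∨ a * b = 0) :
    wedge (Pi.single s a) (Pi.single t b) = 0 := by
  have h'' : s ≠ t → a * b = 0 := fun hst => h.resolve_left hst
  ext i
  fin_cases s <;> fin_cases t <;> fin_cases i <;> simp [wedge] <;> simpa using h''

/-- The coefficients `w_{st}` of an element of `K₂`, extended to all pairs of indices by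
`w_{ts} = -w_{st}`. -/
def skewCoeff (w : Fin 3 → R) : Matrix (Fin 3) (Fin 3) R :=
  !![0, w 0, w 1; -w 0, 0, w 2; -w 1, -w 2, 0]

theorem skewCoeff_add (w w' : Fin 3 → R) (s t : Fin 3) :
    skewCoeff (w + w') s t = skewCoeff w s t + skewCoeff w' s t := by
  fin_cases s <;> fin_cases t <;> simp [skewCoeff] <;> ring

theorem skewCoeff_smul {A : Type*} [CommRing A] [Algebra A R] (c : A) (w : Fin 3 → R)
    (s t : Fin 3) : skewCoeff (c • w) s t = c • skewCoeff w s t := by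
  fin_cases s <;> fin_cases t <;> simp [skewCoeff]

theorem skewCoeff_wedge (u v : Fin 3 → R) (s t : Fin 3) :
    skewCoeff (wedge u v) s t = u s * v t - u t * v s := by
  fin_cases s <;> fin_cases t <;> simp [skewCoeff, wedge]

theorem skewCoeff_mem {I : Ideal R} {w : Fin 3 → R} (hw : ∀ r, w r ∈ I) (s t : Fin 3) :
    skewCoeff w s t ∈ I := by
  fin_cases s <;> fin_cases t <;> simp [skewCoeff, hw]

end KoszulComplex

/-! ### Exactness over the polynomial ring and generators of `A₁` -/

section PolynomialRing

variable {k : Type*} [Field k]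

theorem mono_mul_mono (d e : Fin 3 →₀ ℕ) : mono k d * mono k e = mono k (d + e) := by
  simp [mono, monomial_mul]

theorem vars_eq (I : Ideal (MvPolynomial (Fin 3) k)) :
    vars k I = Ideal.Quotient.mk I ∘ X := rfl

/-- The Koszul complex on the variables of `k[x, y, z]` is exact in degree `1`: `z` is regular
modulo `x, y`, and `x` and `y` are coprime. -/
theorem exists_phi2_X_eq (u : Fin 3 → MvPolynomial (Fin 3) k) (h : phi1 X u = 0) :
    ∃ w, phi2 X w = u := by
  have h' : u 0 * X 0 + u 1 * X 1 + u 2 * X 2 = 0 := by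
    simpa [phi1, Fintype.linearCombination_apply, Fin.sum_univ_three] using h
  have hmem : u 2 * X 2 ∈
      Ideal.span ((X : Fin 3 → MvPolynomial (Fin 3) k) '' ({0, 1} : Set (Fin 3))) := by
    have : u 2 * X 2 = (-u 0) * X 0 + (-u 1) * X 1 := by linear_combination h'
    rw [this]
    exact add_mem (Ideal.mul_mem_left _ _ (Ideal.subset_span ⟨0, by simp, rfl⟩))
      (Ideal.mul_mem_left _ _ (Ideal.subset_span ⟨1, by simp, rfl⟩))
  have hmem2 : u 2 ∈
      Ideal.span ((X : Fin 3 → MvPolynomial (Fin 3) k) '' ({0, 1} : Set (Fin 3))) := by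
    rw [mem_ideal_span_X_image] at hmem ⊢
    intro d hd
    obtain ⟨i, hi, hdi⟩ := hmem (d + Finsupp.single 2 1) (by
      rw [mem_support_iff, coeff_mul_X]; exact mem_support_iff.1 hd)
    refine ⟨i, hi, ?_⟩
    rcases hi with rfl | rfl <;> simpa using hdi
  rw [Set.image_pair, Ideal.mem_span_pair] at hmem2
  obtain ⟨p, q, hpq⟩ := hmem2
  have h2 : X 0 * (u 0 + X 2 * p) = -(X 1 * (u 1 + X 2 * q)) := by
    linear_combination h' + X 2 * hpq
  have hdvd : (X 1 : MvPolynomial (Fin 3) k) ∣ X 0 * (u 0 + X 2 * p) :=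
    ⟨-(u 1 + X 2 * q), by rw [h2]; ring⟩
  have hdvd' : (X 1 : MvPolynomial (Fin 3) k) ∣ u 0 + X 2 * p := by
    refine ((X_prime (R := k)).dvd_or_dvd hdvd).resolve_left fun h10 => ?_
    rw [X_dvd_X] at h10
    simp at h10
  obtain ⟨r, hr⟩ := hdvd'
  have h3 : u 1 + X 2 * q = -(X 0 * r) := by
    apply mul_left_cancel₀ (X_ne_zero (1 : Fin 3) : (X 1 : MvPolynomial (Fin 3) k) ≠ 0)
    rw [hr] at h2
    linear_combination h2
  refine ⟨![-r, p, q], ?_⟩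
  ext1 i
  fin_cases i
  · simp [phi2]
    linear_combination -hr
  · simp [phi2]
    linear_combination -h3
  · simp [phi2]
    linear_combination hpq

variable {I : Ideal (MvPolynomial (Fin 3) k)}

/-- `𝔪` annihilates `A₂`, so that `S` acts on it through the constant coefficient. -/
theorem mk_smul_A2 (f : MvPolynomial (Fin 3) k) (ξ : A2 (vars k I)) :
    Ideal.Quotient.mk I f • ξ = constantCoeff f • ξ := by
  induction f using MvPolynomial.induction_on with
  | C a =>
    rw [constantCoeff_C]
    exact algebraMap_smul (MvPolynomial (Fin 3) k ⧸ I) a ξ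
  | add p q hp hq => rw [map_add, map_add, add_smul, add_smul, hp, hq]
  | mul_X p t hp =>
    have h : (Ideal.Quotient.mk I p * vars k I t) • ξ = 0 := mul_smul_A2_eq_zero _ _ t ξ
    rw [map_mul, map_mul, constantCoeff_X, mul_zero, zero_smul]
    exact h

/-- The element `(xᵉ / x_t) e_t` of `S³`, for an exponent vector `e` with `e t ≠ 0`. Modulo an ideal
containing the monomial `xᵉ` it becomes a cycle. -/
noncomputable def monoCycle (e : Fin 3 →₀ ℕ) (t : Fin 3) : Fin 3 → MvPolynomial (Fin 3) k :=
  Pi.single t (mono k (e - Finsupp.single t 1))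

theorem phi1_monoCycle {e : Fin 3 →₀ ℕ} {t : Fin 3} (ht : e t ≠ 0) :
    phi1 X (monoCycle (k := k) e t) = mono k e := by
  have : Finsupp.single t 1 ≤ e := by
    rw [Finsupp.single_le_iff]; omega
  rw [phi1, monoCycle, Fintype.linearCombination_apply_single, mono, X, smul_eq_mul,
    monomial_mul, tsub_add_cancel_of_le this, mul_one, mono]

/-- The class in `A₁` of the cycle `(xᵉ / x_t) e_t`, for a monomial `xᵉ` in `I`. -/
noncomputable def monoClass {e : Fin 3 →₀ ℕ} (he : mono k e ∈ I) {t : Fin 3} (ht : e t ≠ 0) :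
    A1 (vars k I) :=
  (B1 (vars k I)).mkQ ⟨Ideal.Quotient.mk I ∘ monoCycle e t, by
    rw [LinearMap.mem_ker, vars_eq, phi1_comp_ringHom, phi1_monoCycle ht]
    exact Ideal.Quotient.eq_zero_iff_mem.2 he⟩

theorem mkQ_B1_eq_iff {x : Fin 3 → MvPolynomial (Fin 3) k ⧸ I} (u v : LinearMap.ker (phi1 x)) :
    (B1 x).mkQ u = (B1 x).mkQ v ↔ ∃ w, phi2 x w = u.1 - v.1 := by
  rw [Submodule.mkQ_apply, Submodule.mkQ_apply, Submodule.Quotient.eq]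
  rfl

/-- The class of the cycle `(xᵉ / x_t) e_t` does not depend on `t`. -/
theorem monoClass_eq {e : Fin 3 →₀ ℕ} (he : mono k e ∈ I) {s t : Fin 3} (hs : e s ≠ 0)
    (ht : e t ≠ 0) : monoClass he hs = monoClass he ht := by
  obtain ⟨w, hw⟩ := exists_phi2_X_eq (k := k) (monoCycle e s - monoCycle e t) (by
    rw [map_sub, phi1_monoCycle hs, phi1_monoCycle ht, sub_self])
  refine (mkQ_B1_eq_iff _ _).2 ⟨Ideal.Quotient.mk I ∘ w, ?_⟩
  refine (phi2_comp_ringHom (Ideal.Quotient.mk I) X w).trans ?_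
  rw [hw]
  ext i
  simp

/-- The classes of the cycles attached to generators of `I` generate `A₁`: lift a cycle to `S³`,
write its image in `I` in terms of the generators, and use exactness over `S`. -/
theorem exists_eq_sum_monoClass {n : ℕ} {m : Fin n → Fin 3 →₀ ℕ}
    (hI : I = Ideal.span (Set.range fun i => mono k (m i))) (hm : ∀ i, mono k (m i) ∈ I)
    {τ : Fin n → Fin 3} (hτ : ∀ i, m i (τ i) ≠ 0) (a : A1 (vars k I)) :
    ∃ g : Fin n → MvPolynomial (Fin 3) k,
      a = ∑ i, Ideal.Quotient.mk I (g i) • monoClass (hm i) (hτ i) := by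
  obtain ⟨⟨u, hu⟩, rfl⟩ := (B1 (vars k I)).mkQ_surjective a
  obtain ⟨u, rfl⟩ : ∃ v, Ideal.Quotient.mk I ∘ v = u :=
    Ideal.Quotient.mk_surjective.comp_left u
  rw [LinearMap.mem_ker, vars_eq, phi1_comp_ringHom, Ideal.Quotient.eq_zero_iff_mem] at hu
  have hu' := hu
  rw [hI, Ideal.mem_span_range_iff_exists_fun] at hu'
  obtain ⟨g, hg⟩ := hu'
  refine ⟨g, ?_⟩
  obtain ⟨w, hw⟩ := exists_phi2_X_eq (u - ∑ i, g i • monoCycle (m i) (τ i)) (by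
    rw [map_sub, map_sum, ← hg, sub_eq_zero]
    refine Finset.sum_congr rfl fun i _ => ?_
    rw [map_smul, phi1_monoCycle (hτ i), smul_eq_mul])
  simp only [monoClass, ← map_smul, ← map_sum]
  refine (mkQ_B1_eq_iff _ _).2 ⟨Ideal.Quotient.mk I ∘ w, ?_⟩
  refine (phi2_comp_ringHom (Ideal.Quotient.mk I) X w).trans ?_
  rw [hw]
  ext i
  simp

theorem mulA_monoClass {d e : Fin 3 →₀ ℕ} (hd : mono k d ∈ I) (he : mono k e ∈ I) {s t : Fin 3}
    (hs : d s ≠ 0) (ht : e t ≠ 0) :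
    ∃ w : LinearMap.ker (phi2 (vars k I)),
      w.1 = Ideal.Quotient.mk I ∘ wedge (monoCycle d s) (monoCycle e t) ∧
      mulA (vars k I) (monoClass hd hs) (monoClass he ht) = (B2 (vars k I)).mkQ w :=
  ⟨_, wedge_comp_ringHom _ _ _, mulA_mk _ _ _⟩

theorem mulA_monoClass_eq_zero {d e : Fin 3 →₀ ℕ} (hd : mono k d ∈ I) (he : mono k e ∈ I)
    {s t : Fin 3} (hs : d s ≠ 0) (ht : e t ≠ 0)
    (h : s = t ∨ mono k (d - Finsupp.single s 1) * mono k (e - Finsupp.single t 1) ∈ I) :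
    mulA (vars k I) (monoClass hd hs) (monoClass he ht) = 0 := by
  obtain ⟨w, hw, h'⟩ := mulA_monoClass hd he hs ht
  suffices hw0 : w = 0 by rw [h', hw0, map_zero]
  refine Subtype.ext (hw.trans ?_)
  rw [← wedge_comp_ringHom, monoCycle, monoCycle]
  have hsingle (r : Fin 3) (f : MvPolynomial (Fin 3) k) :
      Ideal.Quotient.mk I ∘ (Pi.single r f : Fin 3 → MvPolynomial (Fin 3) k) =
        Pi.single r (Ideal.Quotient.mk I f) := by
    ext i
    by_cases hi : i = r
    · subst hi; simp
    · simp [hi]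
  rw [hsingle, hsingle]
  refine wedge_single_eq_zero (h.imp_right fun h => ?_)
  rw [← map_mul]
  exact Ideal.Quotient.eq_zero_iff_mem.2 h

theorem mulA_monoClass_swap {d e : Fin 3 →₀ ℕ} (hd : mono k d ∈ I) (he : mono k e ∈ I)
    {s t : Fin 3} (hs : d s ≠ 0) (ht : e t ≠ 0) :
    mulA (vars k I) (monoClass hd hs) (monoClass he ht) =
      -mulA (vars k I) (monoClass he ht) (monoClass hd hs) := by
  rw [monoClass, monoClass, mulA_mk, mulA_mk, ← map_neg]
  exact congrArg _ (Subtype.ext (wedge_swap _ _))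

/-! ### Functionals detecting products -/

/-- The functional on `S³` (the lift of `K₂` to `S`) that sums, over the variables `x_s` dividing `xᵈ`
and `x_t` dividing `xᵉ`, the coefficient of `xᵈ xᵉ / (x_s x_t)` in the coordinate `w_{st}`. -/
noncomputable def pairCoeff (d e : Fin 3 →₀ ℕ) : (Fin 3 → MvPolynomial (Fin 3) k) →ₗ[k] k where
  toFun w := ∑ s ∈ d.support, ∑ t ∈ e.support,
    coeff (d + e - Finsupp.single s 1 - Finsupp.single t 1) (skewCoeff w s t)
  map_add' w w' := by simp only [skewCoeff_add, coeff_add, Finset.sum_add_distrib]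
  map_smul' c w := by
    simp only [skewCoeff_smul, coeff_smul, Finset.smul_sum, RingHom.id_apply]

theorem pairCoeff_apply (d e : Fin 3 →₀ ℕ) (w : Fin 3 → MvPolynomial (Fin 3) k) :
    pairCoeff d e w = ∑ s ∈ d.support, ∑ t ∈ e.support,
      coeff (d + e - Finsupp.single s 1 - Finsupp.single t 1) (skewCoeff w s t) := rfl

theorem coeff_X_mul_sub_single {b : Fin 3 →₀ ℕ} {r s t : Fin 3} (hrs : r ≠ s) (hrt : r ≠ t)
    (c : MvPolynomial (Fin 3) k) :
    coeff (b - Finsupp.single s 1 - Finsupp.single t 1) (X r * c) =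
      if b r = 0 then 0 else
        coeff (b - Finsupp.single s 1 - Finsupp.single t 1 - Finsupp.single r 1) c := by
  rw [coeff_X_mul']
  simp [Finsupp.single_eq_of_ne hrs, Finsupp.single_eq_of_ne hrt]

/-- `pairCoeff` kills boundaries. If `{r, s, t}` are the three indices, then `φ₃ c` has coordinates
`± x_r c`, and all coefficients read off are `±` that of `xᵈ xᵉ / (x y z)` in `c`, or zero when `x_r`
does not divide `xᵈ xᵉ`. When all three variables divide `xᵈ xᵉ`, one of `xᵈ`, `xᵉ` involves two
variables and the other one; the two resulting terms have opposite signs. -/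
theorem pairCoeff_phi3 {d e : Fin 3 →₀ ℕ} (hde : ∀ t, d t = 0 ∨ e t = 0)
    (c : MvPolynomial (Fin 3) k) : pairCoeff d e (phi3 X c) = 0 := by
  have hsum (f : Fin 3 → k) (a : Fin 3 →₀ ℕ) :
      ∑ s ∈ a.support, f s = ∑ s, if a s = 0 then 0 else f s := by
    rw [← Finset.sum_subset (Finset.subset_univ a.support)
      (fun s _ hs => by simp [Finsupp.notMem_support_iff.1 hs])]
    exact Finset.sum_congr rfl fun s hs => by rw [if_neg (Finsupp.mem_support_iff.1 hs)]
  have hc (r s t : Fin 3) (hrs : r ≠ s) (hrt : r ≠ t) (hst : s ≠ t) :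
      coeff (d + e - Finsupp.single s 1 - Finsupp.single t 1) (X r * c) =
        if d r = 0 ∧ e r = 0 then 0 else
          coeff (d + e - Finsupp.single 0 1 - Finsupp.single 1 1 - Finsupp.single 2 1) c := by
    rw [coeff_X_mul_sub_single hrs hrt]
    have : d + e - Finsupp.single s 1 - Finsupp.single t 1 - Finsupp.single r 1 =
        d + e - Finsupp.single 0 1 - Finsupp.single 1 1 - Finsupp.single 2 1 := by
      ext i
      fin_cases r <;> fin_cases s <;> fin_cases t <;> simp_all <;>
        fin_cases i <;> simp
    rw [this]
    simp
  simp only [pairCoeff_apply, hsum, Fin.sum_univ_three]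
  have h0 := hde 0
  have h1 := hde 1
  have h2 := hde 2
  simp [skewCoeff, phi3, coeff_neg, mul_comm c, hc]
  generalize coeff (d + e - Finsupp.single 0 1 - Finsupp.single 1 1 - Finsupp.single 2 1) c = κ
  rcases h0 with h0 | h0 <;> rcases h1 with h1 | h1 <;> rcases h2 with h2 | h2 <;>
    simp only [h0, h1, h2, if_true, true_and, and_true, add_zero] <;> (try split_ifs) <;> simp

end PolynomialRing

/-! ### Coprime isolated pairs of generators -/

section Generators

variable {n : ℕ}

/-- An isolated pair of generators: `i < j`, the monomials `mᵢ` and `mⱼ` are coprime, and they are the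
only generators dividing `mᵢ mⱼ`. -/
def IsIsolatedPair (m : Fin n → Fin 3 →₀ ℕ) (i j : Fin n) : Prop :=
  i < j ∧ (∀ t, m i t = 0 ∨ m j t = 0) ∧ ∀ l, m l ≤ m i + m j → l = i ∨ l = j

variable {k : Type*} [Field k] {I : Ideal (MvPolynomial (Fin 3) k)} {m : Fin n → Fin 3 →₀ ℕ}

theorem mem_span_mono_iff {s : Set (Fin n)} (f : MvPolynomial (Fin 3) k) :
    f ∈ Ideal.span ((fun j => mono k (m j)) '' s) ↔ ∀ e ∈ f.support, ∃ l ∈ s, m l ≤ e := by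
  have : (fun j => mono k (m j)) '' s = (fun e => monomial e (1 : k)) '' (m '' s) := by
    rw [Set.image_image]; rfl
  rw [this, mem_ideal_span_monomial_image]
  simp

theorem mono_mem_iff (hmin : IsMinGenBy k I m) (e : Fin 3 →₀ ℕ) :
    mono k e ∈ I ↔ ∃ l, m l ≤ e := by
  rw [hmin.1, ← Set.image_univ, mem_span_mono_iff]
  classical
  simp [mono, support_monomial]

theorem coeff_eq_zero_of_mem (hmin : IsMinGenBy k I m) {f : MvPolynomial (Fin 3) k} (hf : f ∈ I)
    {e : Fin 3 →₀ ℕ} (he : ∀ l, ¬ m l ≤ e) : coeff e f = 0 := by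
  rw [hmin.1, ← Set.image_univ, mem_span_mono_iff] at hf
  by_contra h
  obtain ⟨l, _, hl⟩ := hf e (mem_support_iff.2 h)
  exact he l hl

theorem mono_gen_mem (hmin : IsMinGenBy k I m) (i : Fin n) : mono k (m i) ∈ I :=
  (mono_mem_iff hmin _).2 ⟨i, le_rfl⟩

theorem eq_of_gen_le (hmin : IsMinGenBy k I m) {i j : Fin n} (h : m j ≤ m i) : j = i := by
  by_contra hji
  refine hmin.2 i ((mem_span_mono_iff _).2 fun e he => ⟨j, hji, ?_⟩)
  classical
  rw [mono, support_monomial, if_neg one_ne_zero, Finset.mem_singleton] at he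
  rwa [he]

theorem gen_ne_zero (hmin : IsMinGenBy k I m) (hI : I ≠ ⊤) (i : Fin n) : ∃ t, m i t ≠ 0 := by
  by_contra! h
  have h0 : m i = 0 := Finsupp.ext h
  have h1 := mono_gen_mem hmin i
  rw [h0] at h1
  exact hI ((Ideal.eq_top_iff_one I).2 h1)

theorem exists_lt_of_ne (hmin : IsMinGenBy k I m) {i l : Fin n} (h : l ≠ i) :
    ∃ t, m l t < m i t := by
  by_contra! hle
  exact h.symm (eq_of_gen_le hmin hle)

theorem mem_maxIdeal_iff (f : MvPolynomial (Fin 3) k) :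
    f ∈ maxIdeal k ↔ constantCoeff f = 0 := by
  rw [maxIdeal, ← Set.image_univ, mem_ideal_span_X_image]
  constructor
  · intro h
    by_contra h0
    obtain ⟨i, _, hi⟩ := h 0 (mem_support_iff.2 h0)
    exact hi rfl
  · intro h d hd
    by_contra! hd0
    have : d = 0 := Finsupp.ext fun t => hd0 t trivial
    subst this
    exact mem_support_iff.1 hd h

theorem mono_mem_maxIdeal {e : Fin 3 →₀ ℕ} (he : ∃ t, e t ≠ 0) : mono k e ∈ maxIdeal k := by
  rw [mem_maxIdeal_iff, mono, constantCoeff_monomial, if_neg]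
  rintro rfl
  simp at he

/-! ### Minimal syzygies -/

theorem sigma_apply (i j r : Fin n) :
    sigma k m i j r = (if r = j then mono k (m i ⊔ m j - m j) else 0) -
      if r = i then mono k (m i ⊔ m j - m i) else 0 := by
  simp [sigma, Pi.single_apply]

/-- If `lcm(mᵢ, mⱼ) / mⱼ` lies in `I`, it is divisible by some generator; this generator divides `mᵢ`,
so it is `mᵢ`, and `mᵢ`, `mⱼ` are coprime. -/
theorem sigma_entries_mem_iff (hmin : IsMinGenBy k I m) {i j : Fin n} (hij : i ≠ j) :
    (∀ r, sigma k m i j r ∈ I) ↔ ∀ t, m i t = 0 ∨ m j t = 0 := by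
  constructor
  · intro h t
    have hj := h j
    rw [sigma_apply, if_pos rfl, if_neg hij.symm, sub_zero, mono_mem_iff hmin] at hj
    obtain ⟨l, hl⟩ := hj
    have hli : l = i := eq_of_gen_le hmin fun t => by
      have := hl t
      simp only [Finsupp.coe_tsub, Pi.sub_apply, Finsupp.sup_apply] at this
      omega
    have := hl t
    simp only [Finsupp.coe_tsub, Pi.sub_apply, Finsupp.sup_apply, hli] at this
    omega
  · intro h r
    have hi : m i ⊔ m j - m j = m i := by
      ext t
      have := h t
      simp only [Finsupp.coe_tsub, Pi.sub_apply, Finsupp.sup_apply]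
      omega
    have hj : m i ⊔ m j - m i = m j := by
      ext t
      have := h t
      simp only [Finsupp.coe_tsub, Pi.sub_apply, Finsupp.sup_apply]
      omega
    rw [sigma_apply, hi, hj]
    refine sub_mem ?_ ?_ <;> split_ifs
    exacts [mono_gen_mem hmin i, zero_mem _, mono_gen_mem hmin j, zero_mem _]

/-- If `m_l` divides `lcm(mᵢ, mⱼ)`, then `σᵢⱼ` is a monomial combination of `σ_{lj}` and `σ_{il}`. -/
theorem sigma_eq_add {i j l : Fin n} (hl : m l ≤ m i ⊔ m j) :
    sigma k m i j = mono k (m i ⊔ m j - m l ⊔ m j) • sigma k m l j +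
      mono k (m i ⊔ m j - m i ⊔ m l) • sigma k m i l := by
  have h1 : m l ⊔ m j ≤ m i ⊔ m j := sup_le hl le_sup_right
  have h2 : m i ⊔ m l ≤ m i ⊔ m j := sup_le le_sup_left hl
  simp only [sigma, smul_sub, ← Pi.single_smul, smul_eq_mul, mono_mul_mono,
    tsub_add_tsub_cancel h1 (le_sup_right : m j ≤ m l ⊔ m j),
    tsub_add_tsub_cancel h1 (le_sup_left : m l ≤ m l ⊔ m j),
    tsub_add_tsub_cancel h2 (le_sup_right : m l ≤ m i ⊔ m l),
    tsub_add_tsub_cancel h2 (le_sup_left : m i ≤ m i ⊔ m l)]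
  abel

/-- For coprime `mᵢ`, `mⱼ` and a third generator `m_l` dividing `mᵢ mⱼ`, both monomial coefficients in
`sigma_eq_add` lie in `𝔪`: by minimality `mᵢ` does not divide `m_l`, so it does not divide
`lcm(m_l, mⱼ)` either, and similarly for `mⱼ`. -/
theorem sigma_mem_maxIdeal_smul (hmin : IsMinGenBy k I m) {i j l : Fin n}
    (hij : ∀ t, m i t = 0 ∨ m j t = 0) (hl : m l ≤ m i + m j) (hli : l ≠ i) (hlj : l ≠ j) :
    sigma k m i j ∈ maxIdeal k • Z2 k m := by
  have hl' : m l ≤ m i ⊔ m j := fun t => by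
    have h1 := hij t
    have h2 := hl t
    simp only [Finsupp.coe_add, Pi.add_apply, Finsupp.sup_apply] at h2 ⊢
    omega
  rw [sigma_eq_add hl']
  obtain ⟨s, hs⟩ := exists_lt_of_ne hmin hli
  obtain ⟨t, ht⟩ := exists_lt_of_ne hmin hlj
  refine add_mem (Submodule.smul_mem_smul (mono_mem_maxIdeal ⟨s, ?_⟩) (sigma_mem_Z2 k m l j))
    (Submodule.smul_mem_smul (mono_mem_maxIdeal ⟨t, ?_⟩) (sigma_mem_Z2 k m i l))
  · have := hij s
    simp only [Finsupp.coe_tsub, Pi.sub_apply, Finsupp.sup_apply]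
    omega
  · have := hij t
    simp only [Finsupp.coe_tsub, Pi.sub_apply, Finsupp.sup_apply]
    omega

theorem coeff_mono_mul (d e : Fin 3 →₀ ℕ) (f : MvPolynomial (Fin 3) k) :
    coeff e (f * mono k d) = if d ≤ e then coeff (e - d) f else 0 := by
  classical
  rw [mono, coeff_mul_monomial']
  simp

/-- For an isolated pair, compare coefficients of `xᵉ mⱼ` in `∑ v_l m_l = 0`, with `xᵉ` a proper
divisor of `mᵢ`: only `v_j` contributes. -/
theorem coeff_eq_zero_of_mem_Z2 {i j : Fin n} (h : IsIsolatedPair m i j)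
    {v : Fin n → MvPolynomial (Fin 3) k} (hv : v ∈ Z2 k m) {e : Fin 3 →₀ ℕ} (he : e ≤ m i)
    (hne : e ≠ m i) : coeff e (v j) = 0 := by
  have h0 : ∑ l, v l * mono k (m l) = 0 := hv
  have h1 := congrArg (coeff (e + m j)) h0
  rw [coeff_sum, Finset.sum_eq_single j, coeff_mono_mul, if_pos le_add_self,
    add_tsub_cancel_right, coeff_zero] at h1
  · exact h1
  · intro l _ hlj
    rw [coeff_mono_mul, if_neg]
    intro hl
    obtain rfl := (h.2.2 l (hl.trans (add_le_add_left he _))).resolve_right hlj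
    refine hne (le_antisymm he fun t => ?_)
    have h2 := hl t
    have h3 := h.2.1 t
    simp only [Finsupp.coe_add, Pi.add_apply] at h2
    omega
  · simp

theorem coeff_eq_zero_of_mem_maxIdeal_smul {i j : Fin n} (h : IsIsolatedPair m i j)
    {v : Fin n → MvPolynomial (Fin 3) k} (hv : v ∈ maxIdeal k • Z2 k m) :
    coeff (m i) (v j) = 0 := by
  classical
  induction hv using Submodule.smul_induction_on' with
  | smul f hf v hv =>
    rw [Pi.smul_apply, smul_eq_mul, coeff_mul]
    refine Finset.sum_eq_zero fun p hp => ?_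
    rw [Finset.HasAntidiagonal.mem_antidiagonal] at hp
    by_cases h2 : p.2 = m i
    · have h1 : p.1 = 0 := by rwa [h2, add_eq_right] at hp
      rw [h1, ← constantCoeff_eq, (mem_maxIdeal_iff f).1 hf, zero_mul]
    · rw [coeff_eq_zero_of_mem_Z2 h hv (hp ▸ le_add_self) h2, mul_zero]
  | add v _ w _ hv hw => rw [Pi.add_apply, coeff_add, hv, hw, add_zero]

theorem IsIsolatedPair.sup_tsub {i j : Fin n} (h : IsIsolatedPair m i j) :
    m i ⊔ m j - m j = m i := by
  ext t
  have := h.2.1 t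
  simp only [Finsupp.coe_tsub, Pi.sub_apply, Finsupp.sup_apply]
  omega

theorem coeff_sigma {i j : Fin n} (h : IsIsolatedPair m i j) :
    coeff (m i) (sigma k m i j j) = 1 := by
  rw [sigma_apply, if_pos rfl, if_neg h.1.ne', sub_zero, h.sup_tsub, mono, coeff_monomial,
    if_pos rfl]

/-- For an isolated pair, no `σ_{pq}` other than `σᵢⱼ` can contribute the monomial `mᵢ` to the
coordinate `j`. -/
theorem coeff_mul_sigma {i j p q : Fin n} (h : IsIsolatedPair m i j) (hpq : p < q)
    (hne : ¬ (p = i ∧ q = j)) (f : MvPolynomial (Fin 3) k) :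
    coeff (m i) (f * sigma k m p q j) = 0 := by
  have key (l : Fin n) (hlj : l ≠ j) (hli : l ≠ i) : ¬ m l ⊔ m j - m j ≤ m i := fun hle => by
    rcases h.2.2 l (fun t => by
      have := hle t
      simp only [Finsupp.coe_tsub, Pi.sub_apply, Finsupp.sup_apply, Finsupp.coe_add,
        Pi.add_apply] at this ⊢
      omega) with h' | h'
    exacts [hli h', hlj h']
  rw [sigma_apply]
  by_cases hqj : j = q
  · subst hqj
    rw [if_pos rfl, if_neg hpq.ne', sub_zero, coeff_mono_mul, if_neg]
    exact key p hpq.ne fun hpi => hne ⟨hpi, rfl⟩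
  · rw [if_neg hqj, zero_sub]
    by_cases hpj : j = p
    · subst hpj
      rw [if_pos rfl, mul_neg, coeff_neg, coeff_mono_mul, if_neg, neg_zero]
      rw [sup_comm]
      exact key q hpq.ne' fun hqi => absurd (hqi ▸ hpq) h.1.asymm
    · simp [if_neg hpj]

/-- The ordered minimal syzygies with entries in `I` are the `σᵢⱼ` of isolated pairs. For an isolated
pair the coefficient of `mᵢ` in coordinate `j` shows both that `σᵢⱼ ∉ 𝔪 Z₂` and that every expression
of `σᵢⱼ` through the `σ_{pq}` involves `σᵢⱼ` itself with a coefficient of constant term `1`. -/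
theorem isOrderedMinimal_and_mem_iff (hmin : IsMinGenBy k I m) (i j : Fin n) :
    (IsOrderedMinimal k m i j ∧ ∀ r, sigma k m i j r ∈ I) ↔ IsIsolatedPair m i j := by
  constructor
  · rintro ⟨⟨hij, ⟨_, hmax⟩, _⟩, hent⟩
    have hcop := (sigma_entries_mem_iff hmin hij.ne).1 hent
    refine ⟨hij, hcop, fun l hl => ?_⟩
    by_contra! hne
    exact hmax (sigma_mem_maxIdeal_smul hmin hcop hl hne.1 hne.2)
  · intro h
    refine ⟨⟨h.1, ⟨sigma_mem_Z2 k m i j, fun hmax => ?_⟩, ?_⟩,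
      (sigma_entries_mem_iff hmin h.1.ne).2 h.2.1⟩
    · have := coeff_eq_zero_of_mem_maxIdeal_smul h hmax
      rw [coeff_sigma h] at this
      exact one_ne_zero this
    · rintro ⟨a, ha, hlt⟩
      have h1 := congrArg (fun v => coeff (m i) (v j)) ha
      simp only [Finset.sum_apply, Pi.smul_apply, smul_eq_mul, coeff_sum] at h1
      rw [Finset.sum_eq_single i, Finset.sum_eq_single j, coeff_sigma h, sigma_apply,
        if_pos rfl, if_neg h.1.ne', sub_zero, h.sup_tsub, coeff_mono_mul, if_pos le_rfl,
        tsub_self] at h1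
      · have h2 := hlt i j h.1 fun hmem => by
          rw [mem_maxIdeal_iff, constantCoeff_eq, ← h1] at hmem
          exact one_ne_zero hmem
        rcases h2 with h2 | h2
        exacts [lt_irrefl _ h2, lt_irrefl _ h2.2]
      · exact fun q hq hqj => coeff_mul_sigma h (Finset.mem_Ioi.1 hq) (fun h' => hqj h'.2) _
      · exact fun hj => absurd (Finset.mem_Ioi.2 h.1) hj
      · exact fun p _ hpi => Finset.sum_eq_zero fun q hq =>
          coeff_mul_sigma h (Finset.mem_Ioi.1 hq) (fun h' => hpi h'.1) _
      · simp

theorem sigma_injOn : Set.InjOn (fun c : Fin n × Fin n => sigma k m c.1 c.2) {c | c.1 < c.2} := by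
  have hmono (e : Fin 3 →₀ ℕ) : mono k e ≠ 0 := by simp [mono]
  have hne {i j r : Fin n} (h : i < j) : sigma k m i j r ≠ 0 ↔ r = i ∨ r = j := by
    rw [sigma_apply]
    by_cases hj : r = j
    · subst hj
      simp [h.ne', hmono]
    · by_cases hi : r = i <;> simp [hi, hj]
      subst hi
      simp [hj, hmono]
  rintro ⟨i, j⟩ (h : i < j) ⟨p, q⟩ (h' : p < q) heq
  have heq' (r : Fin n) : r = i ∨ r = j ↔ r = p ∨ r = q := by
    rw [← hne h, ← hne h']
    exact not_congr (by rw [show sigma k m i j = sigma k m p q from heq])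
  have hi := (heq' i).1 (Or.inl rfl)
  have hj := (heq' j).1 (Or.inr rfl)
  ext <;> simp only <;> omega

end Generators

/-! ### A basis of the span of the products -/

section Products

variable {k : Type*} [Field k] {I : Ideal (MvPolynomial (Fin 3) k)} {n : ℕ}
  {m : Fin n → Fin 3 →₀ ℕ}

/-- For an isolated pair, no generator divides `mᵢ mⱼ / (x_s x_t)` when `x_s ∣ mᵢ` and `x_t ∣ mⱼ`,
so `pairCoeff` reads only coefficients of monomials outside `I`. -/
theorem pairCoeff_eq_zero_of_mem (hmin : IsMinGenBy k I m) {i j : Fin n}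
    (h : IsIsolatedPair m i j) {w : Fin 3 → MvPolynomial (Fin 3) k} (hw : ∀ r, w r ∈ I) :
    pairCoeff (m i) (m j) w = 0 := by
  rw [pairCoeff_apply]
  refine Finset.sum_eq_zero fun s hs => Finset.sum_eq_zero fun t ht =>
    coeff_eq_zero_of_mem hmin (skewCoeff_mem hw s t) fun l hl => ?_
  rw [Finsupp.mem_support_iff] at hs ht
  rcases h.2.2 l (hl.trans (tsub_le_self.trans tsub_le_self)) with rfl | rfl
  · have h1 := hl s
    have h2 := h.2.1 s
    simp only [Finsupp.coe_tsub, Finsupp.coe_add, Pi.sub_apply, Pi.add_apply,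
      Finsupp.single_eq_same] at h1
    omega
  · have h1 := hl t
    have h2 := h.2.1 t
    simp only [Finsupp.coe_tsub, Finsupp.coe_add, Pi.sub_apply, Pi.add_apply,
      Finsupp.single_eq_same] at h1
    omega

theorem monoCycle_mul {d e : Fin 3 →₀ ℕ} {s t a b : Fin 3} :
    monoCycle (k := k) d a s * monoCycle e b t =
      if s = a ∧ t = b then mono k (d - Finsupp.single a 1 + (e - Finsupp.single b 1)) else 0 := by
  by_cases hs : s = a
  · subst hs
    by_cases ht : t = b
    · subst ht
      simp [monoCycle, mono_mul_mono]
    · simp [monoCycle, ht]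
  · simp [monoCycle, hs]

theorem tsub_single_add_tsub_single {d e : Fin 3 →₀ ℕ} {s t : Fin 3} (hs : d s ≠ 0)
    (ht : e t ≠ 0) :
    d - Finsupp.single s 1 + (e - Finsupp.single t 1) =
      d + e - Finsupp.single s 1 - Finsupp.single t 1 := by
  have h1 : Finsupp.single s 1 ≤ d := by rw [Finsupp.single_le_iff]; omega
  have h2 : Finsupp.single t 1 ≤ e := by rw [Finsupp.single_le_iff]; omega
  rw [tsub_add_tsub_comm h1 h2, tsub_add_eq_tsub_tsub]

theorem pairCoeff_wedge_self {d e : Fin 3 →₀ ℕ} (hde : ∀ t, d t = 0 ∨ e t = 0) {s t : Fin 3}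
    (hs : d s ≠ 0) (ht : e t ≠ 0) :
    pairCoeff (k := k) d e (wedge (monoCycle d s) (monoCycle e t)) = 1 := by
  have hs' : e s = 0 := (hde s).resolve_left hs
  rw [pairCoeff_apply, Finset.sum_eq_single s, Finset.sum_eq_single t, skewCoeff_wedge,
    monoCycle_mul, monoCycle_mul, if_pos ⟨rfl, rfl⟩, if_neg, sub_zero,
    tsub_single_add_tsub_single hs ht, mono, coeff_monomial, if_pos rfl]
  · rintro ⟨rfl, _⟩
    exact ht hs'
  · intro b hb hbt
    rw [Finsupp.mem_support_iff] at hb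
    rw [skewCoeff_wedge, monoCycle_mul, monoCycle_mul, if_neg (fun h => hbt h.2), if_neg, sub_zero,
      coeff_zero]
    rintro ⟨rfl, _⟩
    exact hb hs'
  · exact fun h => absurd (Finsupp.mem_support_iff.2 ht) h
  · intro a ha has
    refine Finset.sum_eq_zero fun b hb => ?_
    rw [Finsupp.mem_support_iff] at hb
    rw [skewCoeff_wedge, monoCycle_mul, monoCycle_mul, if_neg (fun h => has h.1), if_neg, sub_zero,
      coeff_zero]
    rintro ⟨rfl, _⟩
    exact hb hs'
  · exact fun h => absurd (Finsupp.mem_support_iff.2 hs) h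

/-- Distinct isolated pairs have distinct products `mᵢ mⱼ`, so the functional of one vanishes on the
product of cycles of the other. -/
theorem pairCoeff_wedge_of_ne {i j p q : Fin n} (h : IsIsolatedPair m i j) (hpq : p < q)
    (hne : ¬ (p = i ∧ q = j)) {a b : Fin 3} (ha : m p a ≠ 0) (hb : m q b ≠ 0) :
    pairCoeff (k := k) (m i) (m j) (wedge (monoCycle (m p) a) (monoCycle (m q) b)) = 0 := by
  have hsum : m i + m j ≠ m p + m q := by
    intro heq
    have hp := h.2.2 p (heq ▸ le_self_add)
    have hq := h.2.2 q (heq ▸ le_add_self)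
    have := h.1
    omega
  have key {s t : Fin 3} (hs : m i s ≠ 0) (ht : m j t ≠ 0)
      (hab : (s = a ∧ t = b) ∨ (s = b ∧ t = a)) :
      m p - Finsupp.single a 1 + (m q - Finsupp.single b 1) ≠
        m i + m j - Finsupp.single s 1 - Finsupp.single t 1 := by
    rw [tsub_single_add_tsub_single ha hb]
    intro heq
    refine hsum (Finsupp.ext fun r => ?_)
    have hr := DFunLike.congr_fun heq r
    have h1 := h.2.1 s
    have h2 := h.2.1 t
    simp only [Finsupp.coe_tsub, Finsupp.coe_add, Pi.sub_apply, Pi.add_apply,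
      Finsupp.single_apply] at hr ⊢
    rcases hab with ⟨rfl, rfl⟩ | ⟨rfl, rfl⟩ <;> grind
  rw [pairCoeff_apply]
  refine Finset.sum_eq_zero fun s hs => Finset.sum_eq_zero fun t ht => ?_
  rw [Finsupp.mem_support_iff] at hs ht
  rw [skewCoeff_wedge, monoCycle_mul, monoCycle_mul, coeff_sub]
  have h1 : coeff (m i + m j - Finsupp.single s 1 - Finsupp.single t 1)
      (if s = a ∧ t = b then
        mono k (m p - Finsupp.single a 1 + (m q - Finsupp.single b 1)) else 0) = 0 := by
    split_ifs with hst
    · rw [mono, coeff_monomial, if_neg (key hs ht (Or.inl hst))]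
    · exact coeff_zero _
  have h2 : coeff (m i + m j - Finsupp.single s 1 - Finsupp.single t 1)
      (if t = a ∧ s = b then
        mono k (m p - Finsupp.single a 1 + (m q - Finsupp.single b 1)) else 0) = 0 := by
    split_ifs with hst
    · rw [mono, coeff_monomial, if_neg (key hs ht (Or.inr hst.symm))]
    · exact coeff_zero _
  rw [h1, h2, sub_zero]

/-- The product in `A₂` of the classes in `A₁` attached to the generators `mᵢ` and `mⱼ`; `τ` selects
a variable dividing each generator. -/
noncomputable def genProduct (hmin : IsMinGenBy k I m) {τ : Fin n → Fin 3}
    (hτ : ∀ i, m i (τ i) ≠ 0) (i j : Fin n) : A2 (vars k I) :=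
  mulA (vars k I) (monoClass (mono_gen_mem hmin i) (hτ i)) (monoClass (mono_gen_mem hmin j) (hτ j))

/-- The products attached to isolated pairs are linearly independent: lift a relation to `S³`; the
functional `pairCoeff` of each pair kills the boundary and the part in `I`, and extracts the
coefficient of that pair. -/
theorem linearIndependent_genProduct (hmin : IsMinGenBy k I m) {τ : Fin n → Fin 3}
    (hτ : ∀ i, m i (τ i) ≠ 0) :
    LinearIndependent k fun c : {c : Fin n × Fin n // IsIsolatedPair m c.1 c.2} =>
      genProduct hmin hτ c.1.1 c.1.2 := by
  classical
  rw [Fintype.linearIndependent_iff]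
  intro g hg ⟨⟨i, j⟩, hij⟩
  choose w hw hw' using fun c : {c : Fin n × Fin n // IsIsolatedPair m c.1 c.2} =>
    mulA_monoClass (mono_gen_mem hmin c.1.1) (mono_gen_mem hmin c.1.2) (hτ c.1.1) (hτ c.1.2)
  have hg' : (B2 (vars k I)).mkQ (∑ c, Ideal.Quotient.mk I (C (g c)) • w c) = 0 := by
    rw [map_sum, ← hg]
    refine Finset.sum_congr rfl fun c _ => ?_
    rw [map_smul, mk_smul_A2, constantCoeff_C, genProduct, hw']
  rw [Submodule.mkQ_apply, Submodule.Quotient.mk_eq_zero] at hg'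
  obtain ⟨d, hd⟩ := hg'
  obtain ⟨d, rfl⟩ := Ideal.Quotient.mk_surjective d
  have hd' := (phi3_comp_ringHom (Ideal.Quotient.mk I) X d).symm.trans hd
  have hmem : ∀ r, ((∑ c : {c : Fin n × Fin n // IsIsolatedPair m c.1 c.2},
      g c • wedge (monoCycle (m c.1.1) (τ c.1.1)) (monoCycle (m c.1.2) (τ c.1.2))) -
        phi3 X d : Fin 3 → MvPolynomial (Fin 3) k) r ∈ I := by
    intro r
    have hr := congrFun hd' r
    rw [← Ideal.Quotient.eq_zero_iff_mem, Pi.sub_apply, map_sub, sub_eq_zero]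
    refine Eq.trans ?_ hr.symm
    simp [hw, Finset.sum_apply, MvPolynomial.smul_eq_C_mul]
  have h0 := pairCoeff_eq_zero_of_mem hmin hij hmem
  rw [map_sub, pairCoeff_phi3 hij.2.1, sub_zero, map_sum,
    Finset.sum_eq_single ⟨(i, j), hij⟩, map_smul, pairCoeff_wedge_self hij.2.1 (hτ i) (hτ j),
    smul_eq_mul, mul_one] at h0
  · exact h0
  · intro c _ hc
    rw [map_smul, pairCoeff_wedge_of_ne hij c.2.1 ?_ (hτ _) (hτ _), smul_zero]
    exact fun h => hc (Subtype.ext (Prod.ext h.1 h.2))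
  · simp

/-- The product attached to any other pair vanishes. If `x_t` divides both generators, both classes
are represented by multiples of `e_t`. If they are coprime and a third generator `m_l` divides
`mᵢ mⱼ`, then by minimality `m_l` has a smaller exponent than `mᵢ` in some `x_s` and a smaller one
than `mⱼ` in some `x_t`; hence `m_l ∣ mᵢ mⱼ / (x_s x_t)`, and the product of the representatives
`(mᵢ / x_s) e_s` and `(mⱼ / x_t) e_t` is zero in `K`. -/
theorem genProduct_eq_zero (hmin : IsMinGenBy k I m) {τ : Fin n → Fin 3}
    (hτ : ∀ i, m i (τ i) ≠ 0) {i j : Fin n} (hij : i < j) (h : ¬ IsIsolatedPair m i j) :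
    genProduct hmin hτ i j = 0 := by
  have hchange {s t : Fin 3} (hs : m i s ≠ 0) (ht : m j t ≠ 0)
      (hst : s = t ∨ mono k (m i - Finsupp.single s 1) * mono k (m j - Finsupp.single t 1) ∈ I) :
      genProduct hmin hτ i j = 0 := by
    rw [genProduct, monoClass_eq _ (hτ i) hs, monoClass_eq _ (hτ j) ht]
    exact mulA_monoClass_eq_zero _ _ hs ht hst
  by_cases hcop : ∀ t, m i t = 0 ∨ m j t = 0
  · obtain ⟨l, hl, hli, hlj⟩ : ∃ l, m l ≤ m i + m j ∧ l ≠ i ∧ l ≠ j := by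
      by_contra! hcon
      exact h ⟨hij, hcop, fun l hl => or_iff_not_imp_left.2 (hcon l hl)⟩
    obtain ⟨s, hs⟩ := exists_lt_of_ne hmin hli
    obtain ⟨t, ht⟩ := exists_lt_of_ne hmin hlj
    refine hchange (s := s) (t := t) (by omega) (by omega) (Or.inr ?_)
    rw [mono_mul_mono, mono_mem_iff hmin]
    refine ⟨l, fun r => ?_⟩
    have h1 := hl r
    have h2 := hcop s
    have h3 := hcop t
    have h4 := hcop r
    simp only [Finsupp.coe_tsub, Finsupp.coe_add, Pi.sub_apply, Pi.add_apply,
      Finsupp.single_apply] at h1 ⊢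
    grind
  · push Not at hcop
    obtain ⟨t, hi, hj⟩ := hcop
    exact hchange hi hj (Or.inl rfl)

theorem A1sq_eq_span (hmin : IsMinGenBy k I m) {τ : Fin n → Fin 3} (hτ : ∀ i, m i (τ i) ≠ 0) :
    A1sq k (vars k I) = Submodule.span k (Set.range
      fun c : {c : Fin n × Fin n // IsIsolatedPair m c.1 c.2} =>
        genProduct hmin hτ c.1.1 c.1.2) := by
  refine le_antisymm (Submodule.span_le.2 ?_) (Submodule.span_mono ?_)
  · rintro _ ⟨a, b, rfl⟩
    have hlt {i j : Fin n} (hij : i < j) : genProduct hmin hτ i j ∈ Submodule.span k (Set.range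
        fun c : {c : Fin n × Fin n // IsIsolatedPair m c.1 c.2} =>
          genProduct hmin hτ c.1.1 c.1.2) := by
      by_cases h : IsIsolatedPair m i j
      · exact Submodule.subset_span ⟨⟨(i, j), h⟩, rfl⟩
      · rw [genProduct_eq_zero hmin hτ hij h]
        exact zero_mem _
    have hall (i j : Fin n) : genProduct hmin hτ i j ∈ Submodule.span k (Set.range
        fun c : {c : Fin n × Fin n // IsIsolatedPair m c.1 c.2} =>
          genProduct hmin hτ c.1.1 c.1.2) := by
      rcases lt_trichotomy i j with h | rfl | h
      · exact hlt h
      · rw [genProduct, mulA_monoClass_eq_zero _ _ _ _ (Or.inl rfl)]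
        exact zero_mem _
      · rw [genProduct, mulA_monoClass_swap]
        exact neg_mem (hlt h)
    obtain ⟨g, rfl⟩ := exists_eq_sum_monoClass hmin.1 (mono_gen_mem hmin) hτ a
    obtain ⟨g', rfl⟩ := exists_eq_sum_monoClass hmin.1 (mono_gen_mem hmin) hτ b
    simp only [map_sum, map_smul, LinearMap.sum_apply, LinearMap.smul_apply, mk_smul_A2]
    exact sum_mem fun i _ => Submodule.smul_mem _ _ (sum_mem fun j _ =>
      Submodule.smul_mem _ _ (hall _ _))
  · rintro _ ⟨c, rfl⟩
    exact ⟨_, _, rfl⟩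

theorem rank_A1sq (hmin : IsMinGenBy k I m) (hI : I ≠ ⊤) :
    Module.rank k (A1sq k (vars k I)) =
      (Nat.card {c : Fin n × Fin n // IsIsolatedPair m c.1 c.2} : Cardinal) := by
  choose τ hτ using gen_ne_zero hmin hI
  have hli := linearIndependent_genProduct hmin hτ
  classical
  rw [A1sq_eq_span hmin hτ, rank_eq_card_basis (Module.Basis.span hli), Nat.card_eq_fintype_card]

theorem ncard_S2_entries_mem (hmin : IsMinGenBy k I m) :
    {s ∈ S2 k m | ∀ r, s r ≠ 0 → s r ∈ I}.ncard =
      Nat.card {c : Fin n × Fin n // IsIsolatedPair m c.1 c.2} := by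
  have : {s ∈ S2 k m | ∀ r, s r ≠ 0 → s r ∈ I} =
      (fun c : Fin n × Fin n => sigma k m c.1 c.2) '' {c | IsIsolatedPair m c.1 c.2} := by
    ext s
    constructor
    · rintro ⟨⟨i, j, h, rfl⟩, hs⟩
      refine ⟨(i, j), (isOrderedMinimal_and_mem_iff hmin i j).1 ⟨h, fun r => ?_⟩, rfl⟩
      by_cases h0 : sigma k m i j r = 0
      · rw [h0]
        exact zero_mem _
      · exact hs r h0
    · rintro ⟨⟨i, j⟩, h, rfl⟩
      obtain ⟨h1, h2⟩ := (isOrderedMinimal_and_mem_iff hmin i j).2 h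
      exact ⟨⟨i, j, h1, rfl⟩, fun r _ => h2 r⟩
  rw [this, (sigma_injOn.mono fun c hc => hc.1).ncard_image, ← Nat.card_coe_set_eq]
  rfl

theorem card_f2_entries_mem (hmin : IsMinGenBy k I m) :
    Nat.card {c // ∀ r, f2 k m r c ∈ I} =
      Nat.card {c : Fin n × Fin n // IsIsolatedPair m c.1 c.2} :=
  Nat.card_congr ((Equiv.subtypeSubtypeEquivSubtypeInter
      (fun c : Fin n × Fin n => IsOrderedMinimal k m c.1 c.2)
      (fun c => ∀ r, sigma k m c.1 c.2 r ∈ I)).trans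
    (Equiv.subtypeEquivRight fun c => isOrderedMinimal_and_mem_iff hmin c.1 c.2))

end Products

end TrivariateKoszul

theorem corollary3p4 (k : Type*) [Field k] (I : Ideal (MvPolynomial (Fin 3) k))
    (n : ℕ) (m : Fin n → Fin 3 →₀ ℕ)
    (hmin : TrivariateKoszul.IsMinGenBy k I m)
    (hprim : I.IsPrimary) (hrad : I.radical = TrivariateKoszul.maxIdeal k) :
    Module.rank k (TrivariateKoszul.A1sq k (TrivariateKoszul.vars k I)) =
        (({s ∈ TrivariateKoszul.S2 k m | ∀ r, s r ≠ 0 → s r ∈ I}.ncard : ℕ) : Cardinal) ∧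
    Module.rank k (TrivariateKoszul.A1sq k (TrivariateKoszul.vars k I)) =
        ((Nat.card {c // ∀ r, TrivariateKoszul.f2 k m r c ∈ I} : ℕ) : Cardinal) := by
  rw [TrivariateKoszul.ncard_S2_entries_mem hmin, TrivariateKoszul.card_f2_entries_mem hmin]
  exact ⟨TrivariateKoszul.rank_A1sq hmin hprim.ne_top, TrivariateKoszul.rank_A1sq hmin hprim.ne_top⟩
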